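/- Terminology. A metric space is boundedly compact if all its closed balls are compact; $B_R(\rho,r)$ is the open ball. A metric $R$ on a non-empty set $F$ is a resistance metric if for every non-empty finite $V\subseteq F$ there is an electrical network (a finite connected simple graph with symmetric conductances that are positive exactly on the edges) with vertex set $V$ whose effective resistance is $R|_{V\times V}$. A resistance form $(\mathcal E,\mathcal F)$ on $F$ consists of a linear space $\mathcal F\subseteq\mathbb R^F$ containing the constants and a non-negative symmetric bilinear form $\mathcal E$ on $\mathcal F$ such that: $\mathcal E(f,f)=0$ iff $f$ is constant; $\mathcal F$ modulo constants is a Hilbert space under $\mathcal E$; $\mathcal F$ separates points; $R_{(\mathcal E,\mathcal F)}(x,y)=\sup\{|f(x)-f(y)|^2/\mathcal E(f,f): f\in\mathcal F,\ \mathcal E(f,f)>0\}<\infty$ for all $x,y$; and for $f\in\mathcal F$, $\bar f=(f\wedge 1)\vee 0$ is in $\mathcal F$ with $\mathcal E(\bar f,\bar f)\le\mathcal E(f,f)$. It is associated with $(F,R)$ if $R_{(\mathcal E,\mathcal F)}=R$. In that case, for $A,B\subseteq F$, $$R(A,B)=\Big(\inf\{\mathcal E(f,f): f\in\mathcal F,\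 f|_A=1,\ f|_B=0\}\Big)^{-1}\in[0,\infty]$$ ($0$ if there is no such $f$, $\infty$ if the infimum is $0$), $R(\rho,B)=R(\{\rho\},B)$, and the form is recurrent if $\lim_{r\to\infty}R(\rho,B_R(\rho,r)^c)=\infty$ for every $\rho\in F$ (equivalently, for some $\rho\in F$). In a boundedly compact space $(M,d)$ with root $\rho_M$ put, for closed sets $A,B$, $d_{\bar H,\rho_M}(A,B)=\int_0^\infty e^{-r}\big(1\wedge d_H(A^{(r)},B^{(r)})\big)\,dr$, where $d_H$ is the Hausdorff distance and $A^{(r)}$ is the closure of $A\cap B_d(\rho_M,r)$. The local Gromov–Hausdorff topology on rooted boundedly compact spaces is induced by the metric $\inf d_{\bar H,\rho_M}(f_1(F_1),f_2(F_2))$, the infimum over all rooted boundedly compact spaces $(M,d,\rho_M)$ and all root- and distance-preserving maps $f_i:F_i\to M$. Theorem. For each $n\ge 1$ let $(F_n,R_n,\rho_n)$ be a rooted boundedly compact metric space such that $R_n$ is a resistance metric. Suppose that $(F_n,R_n,\rho_n)$ converges to a rooted boundedly compact metric space $(F,R,\rho)$ in the local Gromov–Hausdorff topology. Then $R$ is a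 resistance metric, there are resistance forms associated with $(F_n,R_n)$, $n\ge1$, and with $(F,R)$, and with the resistances between sets given by them, both of the following limits exist in $[0,\infty]$ and $$\lim_{r\to\infty}R(\rho,B_R(\rho,r)^c)\ \ge\ \lim_{r\to\infty}\limsup_{n\to\infty}R_n(\rho_n,B_{R_n}(\rho_n,r)^c).$$ In particular, if $\lim_{r\to\infty}\limsup_{n\to\infty}R_n(\rho_n,B_{R_n}(\rho_n,r)^c)=\infty$, then the resistance form associated with $(F,R)$ is recurrent. -/

import Mathlib

universe u

open Filter Topology MeasureTheory
open scoped ENNReal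

noncomputable section

/-! ### Finite electrical networks and resistance metrics -/

/-- An electrical network with finite vertex set `V`: a connected simple graph together with a
symmetric, non-negative conductance function which is positive exactly on the edges. -/
structure FiniteNetwork (V : Type*) where
  graph : SimpleGraph V
  connected : graph.Connected
  cond : V → V → ℝ
  cond_nonneg : ∀ x y, 0 ≤ cond x y
  cond_symm : ∀ x y, cond x y = cond y x
  cond_pos_iff : ∀ x y, 0 < cond x y ↔ graph.Adj x y

namespace FiniteNetwork

variable {V : Type*} [Fintype V]

/-- The energy `½ ∑_{x,y} c(x,y) (f(x) - f(y))²`. -/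
def energy (G : FiniteNetwork V) (f : V → ℝ) : ℝ :=
  (1 / 2) * ∑ x, ∑ y, G.cond x y * (f x - f y) ^ 2

/-- The effective resistance between two vertices,
`sup { |f(x) - f(y)|² / E(f,f) : E(f,f) > 0 }`. -/
def resistance (G : FiniteNetwork V) (x y : V) : ℝ≥0∞ :=
  ⨆ (f : V → ℝ) (_ : 0 < G.energy f), ENNReal.ofReal (|f x - f y| ^ 2 / G.energy f)

end FiniteNetwork

/-- The metric of `X` is a resistance metric: its restriction to any non-empty finite subset `V`
is the effective resistance of some electrical network with vertex set `V`. -/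
def IsResistanceMetric (X : Type*) [MetricSpace X] : Prop :=
  ∀ V : Finset X, V.Nonempty →
    ∃ G : FiniteNetwork V, ∀ x y : V, G.resistance x y = edist (x : X) (y : X)

/-! ### Resistance forms -/

/-- A resistance form on `X`. -/
structure ResistanceForm (X : Type*) where
  /-- The domain, a linear space of real functions on `X`. -/
  dom : Submodule ℝ (X → ℝ)
  /-- The bilinear form. -/
  form : dom →ₗ[ℝ] dom →ₗ[ℝ] ℝ
  const_mem : ∀ c : ℝ, (fun _ => c) ∈ dom
  symm : ∀ f g, form f g = form g f
  nonneg : ∀ f, 0 ≤ form f f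
  form_self_eq_zero_iff : ∀ f : dom, form f f = 0 ↔ ∃ c : ℝ, ∀ x, (f : X → ℝ) x = c
  /-- The quotient of the domain by the constants is complete. -/
  complete : ∀ u : ℕ → dom,
    (∀ ε : ℝ, 0 < ε → ∃ N, ∀ m ≥ N, ∀ n ≥ N, form (u m - u n) (u m - u n) < ε) →
    ∃ v : dom, Tendsto (fun n => form (u n - v) (u n - v)) atTop (𝓝 0)
  separates : ∀ x y, x ≠ y → ∃ f : dom, (f : X → ℝ) x ≠ (f : X → ℝ) y
  resistance_lt_top : ∀ x y,
    (⨆ (f : dom) (_ : 0 < form f f),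
      ENNReal.ofReal (|(f : X → ℝ) x - (f : X → ℝ) y| ^ 2 / form f f)) < ⊤
  /-- The Markov property. -/
  markov : ∀ f : dom, ∃ g : dom,
    (∀ x, (g : X → ℝ) x = max (min ((f : X → ℝ) x) 1) 0) ∧ form g g ≤ form f f

namespace ResistanceForm

variable {X : Type*}

/-- `R_{(E,F)}(x,y) = sup { |f(x) - f(y)|² / E(f,f) : f ∈ F, E(f,f) > 0 }`. -/
def resistance (E : ResistanceForm X) (x y : X) : ℝ≥0∞ :=
  ⨆ (f : E.dom) (_ : 0 < E.form f f),
    ENNReal.ofReal (|(f : X → ℝ) x - (f : X → ℝ) y| ^ 2 / E.form f f)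

/-- `E` is the resistance form associated with the metric of `X`. -/
def IsAssociated [MetricSpace X] (E : ResistanceForm X) : Prop :=
  ∀ x y, E.resistance x y = edist x y

/-- The effective resistance between sets,
`R(A,B) = (inf { E(f,f) : f ∈ F, f = 1 on A, f = 0 on B })⁻¹`.
It is `0` if there is no such `f`, and `∞` if the infimum is `0`. -/
def effRes (E : ResistanceForm X) (A B : Set X) : ℝ≥0∞ :=
  (⨅ (f : E.dom) (_ : ∀ x ∈ A, (f : X → ℝ) x = 1) (_ : ∀ x ∈ B, (f : X → ℝ) x = 0),
    ENNReal.ofReal (E.form f f))⁻¹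

/-- A resistance form (with the metric of `X` as its resistance metric) is recurrent if
`R(ρ, B(ρ,r)ᶜ) → ∞` as `r → ∞`, for any choice of the root `ρ`. -/
def IsRecurrent [MetricSpace X] (E : ResistanceForm X) : Prop :=
  ∀ ρ : X, Tendsto (fun r : ℝ => E.effRes {ρ} (Metric.ball ρ r)ᶜ) atTop (𝓝 ⊤)

end ResistanceForm

/-! ### The local Gromov-Hausdorff metric -/

/-- The local Hausdorff metric with root `ρ`,
`∫₀^∞ e^{-r} (1 ∧ d_H(A^{(r)}, B^{(r)})) dr` with `A^{(r)} = cl(A ∩ B(ρ,r))`. -/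
def localHausdorffDist {M : Type*} [MetricSpace M] (ρ : M) (A B : Set M) : ℝ≥0∞ :=
  ∫⁻ r in Set.Ioi (0 : ℝ), ENNReal.ofReal (Real.exp (-r)) *
    min 1 (Metric.hausdorffEDist (closure (A ∩ Metric.ball ρ r)) (closure (B ∩ Metric.ball ρ r)))

/-- The local Gromov-Hausdorff metric between rooted boundedly-compact metric spaces: the infimum of
the local Hausdorff distance of the images over all root-preserving isometric embeddings into a
common rooted boundedly-compact metric space. -/
def localGHDist {X Y : Type u} [MetricSpace X] [MetricSpace Y] (ρX : X) (ρY : Y) : ℝ≥0∞ :=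
  ⨅ (M : Type u) (_ : MetricSpace M) (_ : ProperSpace M) (ρ : M) (f : X → M) (g : Y → M)
    (_ : Isometry f) (_ : Isometry g) (_ : f ρX = ρ) (_ : g ρY = ρ),
    localHausdorffDist ρ (Set.range f) (Set.range g)

end

/-! The energy of a function is determined by the resistance metric through a dual formula over
finite sets. Let `potential o x` represent `f ↦ f x - f o`. The Gram matrix of these potentials is
the Gromov product, so it involves distances only. The energy of `f` is then the supremum, over
finitely supported weights `w`, of `2 ∑ w x (f x - f o) - ∑∑ w x w y gromovProduct o x y`; the two
directions are `IsAssociated.dual_le` and `IsAssociated.exists_of_dual_le`. Each expression uses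
finitely many points and is continuous in the distances and in the values of `f`. Hence energy is
lower semicontinuous when both converge pointwise (`IsAssociated.exists_of_tendsto`).

Local Gromov-Hausdorff convergence supplies maps `p n` from the limit space along which all
distances converge and the root is eventually preserved. Functions that are 1 at the root, 0 off the
ball of radius `r` and of energy at most `1/a` then have an ultrafilter limit on the limit space.
This limit competes for every radius `s > r` with energy still at most `1/a`, which is
`IsAssociated.limsup_effRes_le`; letting `r` grow gives the inequality.

Resistance forms exist because the energies of the networks on finite subsets increase with the
subset; their limit is the form. That the limit metric is a resistance metric follows from
compactness of the conductances on each finite set. -/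

/-- A bounded function has a limit along every ultrafilter. -/
theorem Ultrafilter.exists_tendsto_of_eventually_abs_le {ι : Type*} (U : Ultrafilter ι)
    (a : ι → ℝ) (C : ℝ) (h : ∀ᶠ i in (U : Filter ι), |a i| ≤ C) :
    ∃ b, Tendsto a U (𝓝 b) := by
  obtain ⟨b, -, hb⟩ := (isCompact_Icc (a := -C) (b := C)).ultrafilter_le_nhds (U.map a) (by
    rw [le_principal_iff]
    exact h.mono fun i hi => abs_le.1 hi)
  exact ⟨b, hb⟩

/-! ### Hilbert space theory of resistance forms: Riesz representation and potentials. -/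

namespace ResistanceForm

variable {X : Type*} (E : ResistanceForm X)

theorem form_add_self (f g : E.dom) :
    E.form (f + g) (f + g) = E.form f f + 2 * E.form f g + E.form g g := by
  simp only [map_add, LinearMap.add_apply, E.symm g f]; ring

theorem form_sub_self (f g : E.dom) :
    E.form (f - g) (f - g) = E.form f f - 2 * E.form f g + E.form g g := by
  simp only [map_sub, LinearMap.sub_apply, E.symm g f]; ring

theorem form_add_smul_self (f g : E.dom) (t : ℝ) :
    E.form (f + t • g) (f + t • g) = E.form f f + 2 * t * E.form f g + t ^ 2 * E.form g g := by
  simp only [form_add_self, map_smul, LinearMap.smul_apply, smul_eq_mul]; ring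

theorem form_sq_le (f g : E.dom) : E.form f g ^ 2 ≤ E.form f f * E.form g g := by
  have h : ∀ t : ℝ, 0 ≤ E.form g g * (t * t) + 2 * E.form f g * t + E.form f f := fun t => by
    have := E.nonneg (f + t • g)
    rw [form_add_smul_self] at this
    linarith
  have := discrim_le_zero h
  rw [discrim] at this
  linarith

/-- The constant function `c` as an element of the domain. -/
def const (c : ℝ) : E.dom := ⟨fun _ => c, E.const_mem c⟩

theorem form_const_left (c : ℝ) (f : E.dom) : E.form (E.const c) f = 0 := by
  have h : E.form (E.const c) (E.const c) = 0 := (E.form_self_eq_zero_iff _).2 ⟨c, fun _ => rfl⟩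
  have := E.form_sq_le (E.const c) f
  rw [h, zero_mul] at this
  exact pow_eq_zero_iff two_ne_zero |>.1 (le_antisymm this (sq_nonneg _))

theorem form_add_const_self (f : E.dom) (c : ℝ) :
    E.form (f + E.const c) (f + E.const c) = E.form f f := by
  rw [form_add_self, E.symm f (E.const c), form_const_left, form_const_left]; ring

theorem sq_sub_le (f : E.dom) (x y : X) :
    ((f : X → ℝ) x - (f : X → ℝ) y) ^ 2 ≤ (E.resistance x y).toReal * E.form f f := by
  rcases (E.nonneg f).eq_or_lt with h | h
  · obtain ⟨c, hc⟩ := (E.form_self_eq_zero_iff f).1 h.symm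
    simp [hc, ← h]
  · have hR : E.resistance x y ≠ ⊤ := (E.resistance_lt_top x y).ne
    rw [← div_le_iff₀ h, ← ENNReal.ofReal_le_iff_le_toReal hR, ← sq_abs]
    exact le_iSup₂ (f := fun (f : E.dom) (_ : 0 < E.form f f) =>
      ENNReal.ofReal (|(f : X → ℝ) x - (f : X → ℝ) y| ^ 2 / E.form f f)) f h

theorem tendsto_form_left {u : ℕ → E.dom} {v : E.dom}
    (h : Tendsto (fun n => E.form (u n - v) (u n - v)) atTop (𝓝 0)) (g : E.dom) :
    Tendsto (fun n => E.form (u n) g) atTop (𝓝 (E.form v g)) := by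
  have h1 : Tendsto (fun n => E.form (u n - v) g ^ 2) atTop (𝓝 0) := by
    refine squeeze_zero (fun n => sq_nonneg _) (fun n => E.form_sq_le _ _) ?_
    simpa using h.mul_const (E.form g g)
  have h2 : Tendsto (fun n => E.form (u n - v) g) atTop (𝓝 0) := by
    rw [tendsto_zero_iff_abs_tendsto_zero]
    have := (Real.continuous_sqrt.tendsto _).comp h1
    simpa [Function.comp_def, Real.sqrt_sq_eq_abs] using this
  have := h2.add_const (E.form v g)
  simpa using this

/-- A version of the Riesz representation theorem: a linear functional `ℓ` on the source of
`T : S → dom` which is bounded with respect to the energy of `T` is represented by an element of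
the domain. -/
theorem exists_representer {S : Type*} [AddCommGroup S] [Module ℝ S] (T : S →ₗ[ℝ] E.dom)
    (l : S →ₗ[ℝ] ℝ) (C : ℝ) (h : ∀ s, 2 * l s - E.form (T s) (T s) ≤ C) :
    ∃ g : E.dom, (∀ s, E.form g (T s) = l s) ∧ E.form g g ≤ C := by
  -- Direct method: images of a minimizing sequence of `J` converge to the representer. The
  -- hypothesis says that `-C` bounds `J` below.
  set J : S → ℝ := fun s => E.form (T s) (T s) - 2 * l s with hJ
  have hbdd : BddBelow (Set.range J) := ⟨-C, by rintro _ ⟨s, rfl⟩; have := h s; simp only [hJ]; linarith⟩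
  set m := ⨅ s, J s with hm
  have hmle : ∀ s, m ≤ J s := ciInf_le hbdd
  have hex : ∀ n : ℕ, ∃ s, J s < m + 1 / ((n : ℝ) + 1) := fun n =>
    exists_lt_of_ciInf_lt (lt_add_of_pos_right _ Nat.one_div_pos_of_nat)
  choose s hs using hex
  have hlim : Tendsto (fun n : ℕ => 1 / ((n : ℝ) + 1)) atTop (𝓝 0) :=
    tendsto_one_div_add_atTop_nhds_zero_nat
  have hcauchy : ∀ ε : ℝ, 0 < ε → ∃ N, ∀ a ≥ N, ∀ b ≥ N,
      E.form (T (s a) - T (s b)) (T (s a) - T (s b)) < ε := by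
    intro ε hε
    obtain ⟨N, hN⟩ := exists_nat_one_div_lt (show 0 < ε / 4 by positivity)
    refine ⟨N, fun a ha b hb => ?_⟩
    -- Parallelogram law: the linear parts of `J` cancel against the midpoint.
    have key : E.form (T (s a) - T (s b)) (T (s a) - T (s b)) =
        2 * J (s a) + 2 * J (s b) - 4 * J ((1 / 2 : ℝ) • (s a + s b)) := by
      simp only [hJ, form_sub_self, map_smul, map_add, LinearMap.smul_apply, smul_eq_mul,
        LinearMap.add_apply, E.symm (T (s b)) (T (s a))]
      ring
    have h1 := hs a
    have h2 := hs b
    have h3 := hmle ((1 / 2 : ℝ) • (s a + s b))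
    have h4 : 1 / ((a : ℝ) + 1) ≤ 1 / ((N : ℝ) + 1) := Nat.one_div_le_one_div ha
    have h5 : 1 / ((b : ℝ) + 1) ≤ 1 / ((N : ℝ) + 1) := Nat.one_div_le_one_div hb
    linarith
  obtain ⟨g, hg⟩ := E.complete (fun n => T (s n)) hcauchy
  have hrep : ∀ t, E.form g (T t) = l t := by
    intro t
    -- Moving from `s n` in direction `t` lowers `J` by at most `1/(n+1)`; the discriminant of this
    -- quadratic bounds the first variation.
    have h1 : ∀ n, (E.form (T (s n)) (T t) - l t) ^ 2 ≤ E.form (T t) (T t) * (1 / ((n : ℝ) + 1)) := by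
      intro n
      have h2 : ∀ a : ℝ, 0 ≤ E.form (T t) (T t) * (a * a) +
          2 * (E.form (T (s n)) (T t) - l t) * a + 1 / ((n : ℝ) + 1) := fun a => by
        have h3 := hmle (s n + a • t)
        have h4 := hs n
        simp only [hJ, map_add T, map_smul T, map_add l, map_smul l, form_add_smul_self,
          smul_eq_mul] at h3 h4
        linarith
      have := discrim_le_zero h2
      rw [discrim] at this
      linarith
    have h2 : Tendsto (fun n => (E.form (T (s n)) (T t) - l t) ^ 2) atTop (𝓝 0) := by
      refine squeeze_zero (fun n => sq_nonneg _) h1 ?_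
      simpa using hlim.const_mul (E.form (T t) (T t))
    have h3 := ((E.tendsto_form_left hg (T t)).sub_const (l t)).pow 2
    have := tendsto_nhds_unique h3 h2
    have := pow_eq_zero_iff two_ne_zero |>.1 this
    linarith
  refine ⟨g, hrep, ?_⟩
  have h1 : ∀ n, E.form g g - E.form (T (s n) - g) (T (s n) - g) ≤ C := fun n => by
    have h2 := h (s n)
    rw [← hrep] at h2
    rw [form_sub_self, E.symm (T (s n)) g]
    linarith
  have := le_of_tendsto (tendsto_const_nhds.sub hg) (Eventually.of_forall h1)
  simpa using this

/-- Evaluation at a point, as a linear functional on the domain. -/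
def eval (x : X) : E.dom →ₗ[ℝ] ℝ := (LinearMap.proj x).comp E.dom.subtype

@[simp] theorem eval_apply (x : X) (f : E.dom) : E.eval x f = (f : X → ℝ) x := rfl

/-- Riesz representation of the difference of two evaluations, bounded by `sq_sub_le` and AM-GM.
Cauchy-Schwarz against every `f` shows that the energy of `u` is no smaller than the resistance. -/
theorem exists_potential (o x : X) : ∃ u : E.dom,
    (∀ f : E.dom, E.form u f = (f : X → ℝ) x - (f : X → ℝ) o) ∧
      E.form u u = (E.resistance x o).toReal := by
  obtain ⟨u, hu, hle⟩ := E.exists_representer LinearMap.id (E.eval x - E.eval o)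
    (E.resistance x o).toReal (fun f => by
      have h1 := E.sq_sub_le f x o
      have h2 := E.nonneg f
      have h3 : 0 ≤ (E.resistance x o).toReal := ENNReal.toReal_nonneg
      have h4 := abs_le_of_sq_le_sq (a := 2 * ((f : X → ℝ) x - (f : X → ℝ) o))
        (b := (E.resistance x o).toReal + E.form f f) (by
          nlinarith [sq_nonneg ((E.resistance x o).toReal - E.form f f)]) (by positivity)
      simp only [LinearMap.sub_apply, eval_apply, LinearMap.id_apply]
      linarith [(abs_le.1 h4).2])
  refine ⟨u, hu, le_antisymm hle ?_⟩
  refine ENNReal.toReal_le_of_le_ofReal (E.nonneg u) (iSup₂_le fun f hf => ?_)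
  refine ENNReal.ofReal_le_ofReal ?_
  rw [div_le_iff₀ hf, sq_abs]
  have := E.form_sq_le u f
  rwa [show E.form u f = (f : X → ℝ) x - (f : X → ℝ) o from hu f] at this

/-- The potential `u` at `x` grounded at `o`: `E(u, f) = f x - f o`. -/
noncomputable def potential (o x : X) : E.dom := (E.exists_potential o x).choose

theorem form_potential (o x : X) (f : E.dom) :
    E.form (E.potential o x) f = (f : X → ℝ) x - (f : X → ℝ) o :=
  (E.exists_potential o x).choose_spec.1 f

theorem form_potential_self (o x : X) :
    E.form (E.potential o x) (E.potential o x) = (E.resistance x o).toReal :=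
  (E.exists_potential o x).choose_spec.2

/-- The base point cancels: as a functional, the difference is the potential at `x` grounded at `y`.
-/
theorem form_potential_sub_self (o x y : X) :
    E.form (E.potential o x - E.potential o y) (E.potential o x - E.potential o y) =
      (E.resistance x y).toReal := by
  have h : ∀ f, E.form (E.potential o x - E.potential o y) f = E.form (E.potential y x) f := by
    intro f
    simp only [map_sub, LinearMap.sub_apply, form_potential]; ring
  rw [h, E.symm, h, form_potential_self]

/-! ### The dual formula for the energy in terms of the metric. -/

section Metric

variable {X : Type*} [MetricSpace X] {E : ResistanceForm X}

/-- The Gromov product of `x` and `y` at `o`. -/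
noncomputable def _root_.gromovProduct {X : Type*} [MetricSpace X] (o x y : X) : ℝ :=
  (dist x o + dist y o - dist x y) / 2

theorem IsAssociated.resistance_toReal (hE : E.IsAssociated) (x y : X) :
    (E.resistance x y).toReal = dist x y := by
  rw [hE x y, edist_dist, ENNReal.toReal_ofReal dist_nonneg]

theorem IsAssociated.sq_sub_le (hE : E.IsAssociated) (f : E.dom) (x y : X) :
    ((f : X → ℝ) x - (f : X → ℝ) y) ^ 2 ≤ dist x y * E.form f f := by
  rw [← hE.resistance_toReal]; exact E.sq_sub_le f x y

/-- Polarization. This is where the form is reduced to distances. -/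
theorem IsAssociated.form_potential_potential (hE : E.IsAssociated) (o x y : X) :
    E.form (E.potential o x) (E.potential o y) = gromovProduct o x y := by
  have := E.form_potential_sub_self o x y
  rw [form_sub_self, form_potential_self, form_potential_self] at this
  simp only [hE.resistance_toReal] at this
  rw [gromovProduct]
  linarith

theorem IsAssociated.form_sum_potential_self (hE : E.IsAssociated) (o : X) {ι : Type*}
    (p : ι → X) (s : Finset ι) (w : ι → ℝ) :
    E.form (∑ i ∈ s, w i • E.potential o (p i)) (∑ i ∈ s, w i • E.potential o (p i)) =
      ∑ i ∈ s, ∑ j ∈ s, w i * w j * gromovProduct o (p i) (p j) := by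
  simp only [map_sum, LinearMap.sum_apply, map_smul, LinearMap.smul_apply, smul_eq_mul,
    hE.form_potential_potential, Finset.mul_sum]
  rw [Finset.sum_comm]
  exact Finset.sum_congr rfl fun i _ => Finset.sum_congr rfl fun j _ => by ring

/-- The dual lower bound for the energy. -/
theorem IsAssociated.dual_le (hE : E.IsAssociated) (f : E.dom) (o : X) {ι : Type*} (p : ι → X)
    (s : Finset ι) (w : ι → ℝ) :
    2 * ∑ i ∈ s, w i * ((f : X → ℝ) (p i) - (f : X → ℝ) o) -
      ∑ i ∈ s, ∑ j ∈ s, w i * w j * gromovProduct o (p i) (p j) ≤ E.form f f := by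
  have h := E.nonneg (f - ∑ i ∈ s, w i • E.potential o (p i))
  have hf : ∀ x, E.form f (E.potential o x) = (f : X → ℝ) x - (f : X → ℝ) o := fun x => by
    rw [E.symm, form_potential]
  rw [form_sub_self, hE.form_sum_potential_self] at h
  simp only [map_sum, map_smul, smul_eq_mul, hf] at h
  linarith

/-- A function with finite dual energy belongs to the domain. -/
theorem IsAssociated.exists_of_dual_le (hE : E.IsAssociated) (f : X → ℝ) (o : X) (C : ℝ)
    (h : ∀ (s : Finset X) (w : X → ℝ), 2 * ∑ x ∈ s, w x * (f x - f o) -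
      ∑ x ∈ s, ∑ y ∈ s, w x * w y * gromovProduct o x y ≤ C) :
    ∃ g : E.dom, (g : X → ℝ) = f ∧ E.form g g ≤ C := by
  obtain ⟨g, hg, hgC⟩ := E.exists_representer (Finsupp.linearCombination ℝ (E.potential o))
    (Finsupp.linearCombination ℝ (fun x => f x - f o)) C (fun w => by
      refine le_of_eq_of_le ?_ (h w.support w)
      congr 1
      exact hE.form_sum_potential_self o id w.support w)
  -- The representer has the same increments from `o` as `f`; a constant corrects the value at `o`
  -- at no energy cost.
  refine ⟨g + E.const (f o - (g : X → ℝ) o), ?_, by rwa [form_add_const_self]⟩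
  funext x
  have := hg (Finsupp.single x 1)
  simp only [Finsupp.linearCombination_single, one_smul, E.symm g, form_potential] at this
  change (g : X → ℝ) x + (f o - (g : X → ℝ) o) = f x
  linarith

/-- Lower semicontinuity of the energy under pointwise convergence of resistance metrics. -/
theorem IsAssociated.exists_of_tendsto (hE : E.IsAssociated) {ι : Type*} {l : Filter ι} [l.NeBot]
    {Y : ι → Type*} [∀ i, MetricSpace (Y i)] {G : ∀ i, ResistanceForm (Y i)}
    (hG : ∀ i, (G i).IsAssociated) (p : ∀ i, X → Y i)
    (hp : ∀ x y, Tendsto (fun i => dist (p i x) (p i y)) l (𝓝 (dist x y)))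
    (u : ∀ i, (G i).dom) (C : ℝ) (hC : ∀ᶠ i in l, (G i).form (u i) (u i) ≤ C) (f : X → ℝ)
    (hf : ∀ x, Tendsto (fun i => (u i : Y i → ℝ) (p i x)) l (𝓝 (f x))) [Nonempty X] :
    ∃ g : E.dom, (g : X → ℝ) = f ∧ E.form g g ≤ C := by
  let o : X := Classical.arbitrary X
  refine hE.exists_of_dual_le f o C fun s w => ?_
  -- With `s` and `w` fixed, the dual lower bound for `u i` at the image points passes to the limit
  -- term by term.
  refine le_of_tendsto (x := l) (f := fun i =>
    2 * ∑ x ∈ s, w x * ((u i : Y i → ℝ) (p i x) - (u i : Y i → ℝ) (p i o)) -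
      ∑ x ∈ s, ∑ y ∈ s, w x * w y * gromovProduct (p i o) (p i x) (p i y)) ?_
    (hC.mono fun i hi => ((hG i).dual_le (u i) (p i o) (p i) s w).trans hi)
  refine Tendsto.sub (Tendsto.const_mul _ (tendsto_finsetSum _ fun x _ => ?_))
    (tendsto_finsetSum _ fun x _ => tendsto_finsetSum _ fun y _ => ?_)
  · exact ((hf x).sub (hf o)).const_mul _
  · exact ((((hp x o).add (hp y o)).sub (hp x y)).div_const 2).const_mul _

/-- The trace of a resistance form along an isometric embedding. -/
theorem IsAssociated.exists_comp (hE : E.IsAssociated) {Y : Type*} [MetricSpace Y]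
    {G : ResistanceForm Y} (hG : G.IsAssociated) {p : X → Y} (hp : Isometry p) (u : G.dom)
    [Nonempty X] :
    ∃ g : E.dom, (g : X → ℝ) = (u : Y → ℝ) ∘ p ∧ E.form g g ≤ G.form u u :=
  -- A constant net: lower semicontinuity already contains the fact that restriction does not raise
  -- energy.
  hE.exists_of_tendsto (ι := Unit) (l := pure ()) (Y := fun _ => Y) (fun _ => hG) (fun _ => p)
    (fun x y => by simp [hp.dist_eq]) (fun _ => u) _ (by simp) _
    (fun x => by simp)

end Metric

end ResistanceForm

/-! ### Monotone limits of quadratic forms. -/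

/-- A monotone net of quadratic forms on functions, the limit of which is a resistance form. -/
structure EnergyNet (X I : Type*) [Preorder I] where
  /-- The bilinear forms. -/
  form : I → (X → ℝ) →ₗ[ℝ] (X → ℝ) →ₗ[ℝ] ℝ
  symm : ∀ i f g, form i f g = form i g f
  nonneg : ∀ i f, 0 ≤ form i f f
  mono : ∀ f, Monotone fun i => form i f f
  const_left : ∀ i (c : ℝ) f, form i (fun _ => c) f = 0
  continuous_self : ∀ i, Continuous fun f => form i f f
  /-- A bound for the resistances. -/
  bound : X → X → ℝ
  sq_sub_le : ∀ x y, ∀ᶠ i in atTop, ∀ f : X → ℝ, (f x - f y) ^ 2 ≤ bound x y * form i f f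
  markov : ∀ i (f : X → ℝ), form i (fun x => max (min (f x) 1) 0) (fun x => max (min (f x) 1) 0) ≤
    form i f f
  separates : ∀ x y, x ≠ y → ∃ (f : X → ℝ) (C : ℝ), f x ≠ f y ∧ ∀ i, form i f f ≤ C

namespace EnergyNet

variable {X I : Type*} [Preorder I] (N : EnergyNet X I)

theorem form_add_self (i : I) (f g : X → ℝ) :
    N.form i (f + g) (f + g) = N.form i f f + 2 * N.form i f g + N.form i g g := by
  simp only [map_add, LinearMap.add_apply, N.symm i g f]; ring

theorem form_sub_self (i : I) (f g : X → ℝ) :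
    N.form i (f - g) (f - g) = N.form i f f - 2 * N.form i f g + N.form i g g := by
  simp only [map_sub, LinearMap.sub_apply, N.symm i g f]; ring

theorem form_add_const_self (i : I) (f : X → ℝ) (c : ℝ) :
    N.form i (f + fun _ => c) (f + fun _ => c) = N.form i f f := by
  rw [form_add_self, N.symm i f fun _ => c, N.const_left, N.const_left]; ring

/-- The functions of finite energy. -/
def dom : Submodule ℝ (X → ℝ) where
  carrier := {f | ∃ C, ∀ i, N.form i f f ≤ C}
  zero_mem' := ⟨0, fun i => by simp⟩
  add_mem' := by
    rintro f g ⟨C, hC⟩ ⟨D, hD⟩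
    refine ⟨2 * C + 2 * D, fun i => ?_⟩
    have h1 := N.nonneg i (f - g)
    rw [form_sub_self] at h1
    rw [form_add_self]
    linarith [hC i, hD i]
  smul_mem' := by
    rintro c f ⟨C, hC⟩
    refine ⟨c ^ 2 * C, fun i => ?_⟩
    simp only [map_smul, LinearMap.smul_apply, smul_eq_mul]
    nlinarith [mul_le_mul_of_nonneg_left (hC i) (sq_nonneg c)]

/-- The limit of the forms. -/
noncomputable def limit (f g : X → ℝ) : ℝ := limUnder atTop fun i => N.form i f g

theorem limit_comm (f g : X → ℝ) : N.limit f g = N.limit g f := by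
  simp only [limit, N.symm _ f g]

/-- On the diagonal the net is monotone and bounded; polarization gives the rest. -/
theorem tendsto_limit {f g : X → ℝ} (hf : f ∈ N.dom) (hg : g ∈ N.dom) :
    Tendsto (fun i => N.form i f g) atTop (𝓝 (N.limit f g)) := by
  have key : ∀ h ∈ N.dom, ∃ a, Tendsto (fun i => N.form i h h) atTop (𝓝 a) := by
    rintro h ⟨C, hC⟩
    exact ⟨_, tendsto_atTop_ciSup (N.mono h) ⟨C, by rintro _ ⟨i, rfl⟩; exact hC i⟩⟩
  obtain ⟨a, ha⟩ := key _ (N.dom.add_mem hf hg)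
  obtain ⟨b, hb⟩ := key _ (N.dom.sub_mem hf hg)
  refine tendsto_nhds_limUnder ⟨(a - b) / 4, ?_⟩
  refine ((ha.sub hb).div_const 4).congr fun i => ?_
  rw [form_add_self, form_sub_self]; ring

theorem const_mem (c : ℝ) : (fun _ => c) ∈ N.dom := ⟨0, fun i => (N.const_left i c _).le⟩

variable [IsDirectedOrder I]

theorem form_le_limit {f : X → ℝ} (hf : f ∈ N.dom) (i : I) : N.form i f f ≤ N.limit f f :=
  (N.mono f).ge_of_tendsto (N.tendsto_limit hf hf) i

variable [Nonempty I]

theorem limit_le {f : X → ℝ} {C : ℝ} (h : ∀ i, N.form i f f ≤ C) : N.limit f f ≤ C :=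
  le_of_tendsto (N.tendsto_limit ⟨C, h⟩ ⟨C, h⟩) (Eventually.of_forall h)

theorem limit_sq_sub_le {f : X → ℝ} (hf : f ∈ N.dom) (x y : X) :
    (f x - f y) ^ 2 ≤ N.bound x y * N.limit f f :=
  ge_of_tendsto ((N.tendsto_limit hf hf).const_mul _) ((N.sq_sub_le x y).mono fun _ h => h f)

/-- The limit of the forms, as a bilinear form on the domain. -/
noncomputable def limitForm : N.dom →ₗ[ℝ] N.dom →ₗ[ℝ] ℝ :=
  LinearMap.mk₂ ℝ (fun f g => N.limit f g)
    (fun f g h => tendsto_nhds_unique (N.tendsto_limit (f + g).2 h.2)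
      (((N.tendsto_limit f.2 h.2).add (N.tendsto_limit g.2 h.2)).congr fun i => by simp))
    (fun c f h => tendsto_nhds_unique (N.tendsto_limit (c • f).2 h.2)
      (((N.tendsto_limit f.2 h.2).const_mul c).congr fun i => by simp))
    (fun f g h => tendsto_nhds_unique (N.tendsto_limit f.2 (g + h).2)
      (((N.tendsto_limit f.2 g.2).add (N.tendsto_limit f.2 h.2)).congr fun i => by simp))
    (fun c f h => tendsto_nhds_unique (N.tendsto_limit f.2 (c • h).2)
      (((N.tendsto_limit f.2 h.2).const_mul c).congr fun i => by simp))

@[simp] theorem limitForm_apply (f g : N.dom) : N.limitForm f g = N.limit f g := rfl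

/-- Grounding at `o` turns an energy-Cauchy sequence into a pointwise convergent one. Each form in
the net is continuous under pointwise convergence, so the Cauchy estimate passes to the limit
function at every index, uniformly in the index. -/
theorem limitForm_complete [Nonempty X] (u : ℕ → N.dom)
    (hu : ∀ ε : ℝ, 0 < ε → ∃ M, ∀ m ≥ M, ∀ n ≥ M, N.limitForm (u m - u n) (u m - u n) < ε) :
    ∃ v : N.dom, Tendsto (fun n => N.limitForm (u n - v) (u n - v)) atTop (𝓝 0) := by
  let o : X := Classical.arbitrary X
  have hpt : ∀ x, ∃ a, Tendsto (fun n => (u n : X → ℝ) x - (u n : X → ℝ) o) atTop (𝓝 a) := by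
    refine fun x => cauchySeq_tendsto_of_complete (Metric.cauchySeq_iff.2 fun ε hε => ?_)
    obtain ⟨M, hM⟩ := hu (ε ^ 2 / (|N.bound x o| + 1)) (by positivity)
    refine ⟨M, fun m hm n hn => ?_⟩
    have h1 := N.limit_sq_sub_le (u m - u n).2 x o
    have h2 := hM m hm n hn
    rw [lt_div_iff₀ (by positivity), limitForm_apply] at h2
    have h3 : 0 ≤ N.limit (u m - u n : N.dom) (u m - u n : N.dom) :=
      ge_of_tendsto (N.tendsto_limit (u m - u n).2 (u m - u n).2)
        (Eventually.of_forall fun i => N.nonneg i _)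
    have h4 := mul_le_mul_of_nonneg_right (le_abs_self (N.bound x o)) h3
    rw [Real.dist_eq]
    refine abs_lt_of_sq_lt_sq ?_ hε.le
    calc _ = (((u m - u n : N.dom) : X → ℝ) x - ((u m - u n : N.dom) : X → ℝ) o) ^ 2 := by
          simp only [Submodule.coe_sub, Pi.sub_apply]; ring
      _ < ε ^ 2 := by nlinarith
  choose v hv using hpt
  have hlim : Tendsto (fun n => (u n : X → ℝ) + fun _ => -(u n : X → ℝ) o) atTop (𝓝 v) := by
    rw [tendsto_pi_nhds]
    exact fun x => (hv x).congr fun n => by simp [sub_eq_add_neg]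
  have key : ∀ ε : ℝ, 0 < ε → ∃ M, ∀ n ≥ M, ∀ i,
      N.form i ((u n : X → ℝ) - v) ((u n : X → ℝ) - v) ≤ ε := by
    intro ε hε
    obtain ⟨M, hM⟩ := hu ε hε
    refine ⟨M, fun n hn i => ?_⟩
    refine le_of_tendsto (((N.continuous_self i).tendsto _).comp (hlim.const_sub (u n : X → ℝ))) ?_
    filter_upwards [eventually_ge_atTop M] with m hm
    have h1 := N.form_le_limit (u n - u m).2 i
    have h2 := hM n hn m hm
    rw [limitForm_apply] at h2
    have h3 : (u n : X → ℝ) - ((u m : X → ℝ) + fun _ => -(u m : X → ℝ) o) =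
        ((u n - u m : N.dom) : X → ℝ) + fun _ => (u m : X → ℝ) o := by
      funext x; simp; ring
    simp only [Function.comp_apply]
    rw [h3, form_add_const_self]
    exact h1.trans h2.le
  have hmem : v ∈ N.dom := by
    obtain ⟨M, hM⟩ := key 1 one_pos
    have := N.dom.sub_mem (u M).2 (show (u M : X → ℝ) - v ∈ N.dom from ⟨1, hM M le_rfl⟩)
    rwa [sub_sub_cancel] at this
  refine ⟨⟨v, hmem⟩, Metric.tendsto_atTop.2 fun ε hε => ?_⟩
  obtain ⟨M, hM⟩ := key (ε / 2) (by positivity)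
  refine ⟨M, fun n hn => ?_⟩
  have h1 : N.limitForm (u n - ⟨v, hmem⟩) (u n - ⟨v, hmem⟩) ≤ ε / 2 := N.limit_le (hM n hn)
  have h2 : 0 ≤ N.limitForm (u n - ⟨v, hmem⟩) (u n - ⟨v, hmem⟩) :=
    ge_of_tendsto (N.tendsto_limit (u n - ⟨v, hmem⟩).2 (u n - ⟨v, hmem⟩).2)
      (Eventually.of_forall fun i => N.nonneg i _)
  rw [Real.dist_eq, sub_zero, abs_of_nonneg h2]
  linarith

/-- The resistance form obtained as the limit of a net of quadratic forms. -/
noncomputable def toResistanceForm [Nonempty X] : ResistanceForm X where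
  dom := N.dom
  form := N.limitForm
  const_mem := N.const_mem
  symm f g := N.limit_comm f g
  nonneg f := ge_of_tendsto (N.tendsto_limit f.2 f.2) (Eventually.of_forall fun i => N.nonneg i _)
  form_self_eq_zero_iff f := by
    constructor
    · intro h
      refine ⟨(f : X → ℝ) (Classical.arbitrary X), fun x => ?_⟩
      have h1 := N.limit_sq_sub_le f.2 x (Classical.arbitrary X)
      rw [limitForm_apply] at h
      rw [h, mul_zero] at h1
      exact sub_eq_zero.1 (pow_eq_zero_iff two_ne_zero |>.1 (le_antisymm h1 (sq_nonneg _)))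
    · rintro ⟨c, hc⟩
      have h : (f : X → ℝ) = fun _ => c := funext hc
      rw [limitForm_apply, h]
      exact tendsto_nhds_unique (N.tendsto_limit (N.const_mem c) (N.const_mem c))
        (tendsto_const_nhds.congr fun i => (N.const_left i c _).symm)
  complete := N.limitForm_complete
  separates x y hxy := by
    obtain ⟨f, C, hf, hC⟩ := N.separates x y hxy
    exact ⟨⟨f, C, hC⟩, hf⟩
  resistance_lt_top x y := by
    refine lt_of_le_of_lt (iSup₂_le fun f hf => ?_) (ENNReal.ofReal_lt_top (r := N.bound x y))
    refine ENNReal.ofReal_le_ofReal ?_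
    rw [div_le_iff₀ hf, sq_abs]
    exact N.limit_sq_sub_le f.2 x y
  markov f := by
    have h : ∀ i, N.form i (fun x => max (min ((f : X → ℝ) x) 1) 0)
        (fun x => max (min ((f : X → ℝ) x) 1) 0) ≤ N.limit f f :=
      fun i => (N.markov i f).trans (N.form_le_limit f.2 i)
    exact ⟨⟨_, _, h⟩, fun _ => rfl, N.limit_le h⟩

end EnergyNet

/-! ### Finite networks as resistance forms. -/

theorem sq_clip_sub_le (a b : ℝ) :
    (max (min a 1) 0 - max (min b 1) 0) ^ 2 ≤ (a - b) ^ 2 := by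
  rw [sq_le_sq]
  refine (abs_max_sub_max_le_abs _ _ _).trans ?_
  simpa using abs_min_sub_min_le_max a 1 b 1

namespace FiniteNetwork

variable {V : Type*} [Fintype V] (G : FiniteNetwork V)

/-- The energy as a bilinear form. -/
noncomputable def bilin : (V → ℝ) →ₗ[ℝ] (V → ℝ) →ₗ[ℝ] ℝ :=
  LinearMap.mk₂ ℝ (fun f g => (1 / 2) * ∑ x, ∑ y, G.cond x y * ((f x - f y) * (g x - g y)))
    (fun f g h => by
      simp only [← mul_add, ← Finset.sum_add_distrib, Pi.add_apply]
      exact congrArg _ (Finset.sum_congr rfl fun x _ => Finset.sum_congr rfl fun y _ => by ring))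
    (fun c f h => by
      simp only [smul_eq_mul, Finset.mul_sum, Pi.smul_apply]
      exact Finset.sum_congr rfl fun x _ => Finset.sum_congr rfl fun y _ => by ring)
    (fun f g h => by
      simp only [← mul_add, ← Finset.sum_add_distrib, Pi.add_apply]
      exact congrArg _ (Finset.sum_congr rfl fun x _ => Finset.sum_congr rfl fun y _ => by ring))
    (fun c f h => by
      simp only [smul_eq_mul, Finset.mul_sum, Pi.smul_apply]
      exact Finset.sum_congr rfl fun x _ => Finset.sum_congr rfl fun y _ => by ring)

theorem bilin_apply (f g : V → ℝ) :
    G.bilin f g = (1 / 2) * ∑ x, ∑ y, G.cond x y * ((f x - f y) * (g x - g y)) := rfl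

theorem bilin_self (f : V → ℝ) : G.bilin f f = G.energy f := by
  simp only [bilin_apply, energy, sq]

theorem energy_nonneg (f : V → ℝ) : 0 ≤ G.energy f :=
  mul_nonneg (by norm_num) (Finset.sum_nonneg fun x _ => Finset.sum_nonneg fun y _ =>
    mul_nonneg (G.cond_nonneg x y) (sq_nonneg _))

theorem continuous_energy : Continuous G.energy := by
  unfold energy; fun_prop

theorem energy_clip_le (f : V → ℝ) : G.energy (fun x => max (min (f x) 1) 0) ≤ G.energy f :=
  mul_le_mul_of_nonneg_left (Finset.sum_le_sum fun x _ => Finset.sum_le_sum fun y _ =>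
    mul_le_mul_of_nonneg_left (sq_clip_sub_le _ _) (G.cond_nonneg x y)) (by norm_num)

/-- The ordered pairs `(x, y)` and `(y, x)` both contribute, which absorbs the factor `1/2`. -/
theorem cond_mul_sq_le_energy (f : V → ℝ) (x y : V) :
    G.cond x y * (f x - f y) ^ 2 ≤ G.energy f := by
  classical
  rcases eq_or_ne x y with rfl | hxy
  · simpa using G.energy_nonneg f
  have hn : ∀ a b, 0 ≤ G.cond a b * (f a - f b) ^ 2 := fun a b =>
    mul_nonneg (G.cond_nonneg a b) (sq_nonneg _)
  have h1 : ∀ a b, G.cond a b * (f a - f b) ^ 2 ≤ ∑ b, G.cond a b * (f a - f b) ^ 2 := fun a b =>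
    Finset.single_le_sum (f := fun b => G.cond a b * (f a - f b) ^ 2) (fun b _ => hn a b)
      (Finset.mem_univ b)
  have h2 := Finset.sum_le_sum_of_subset_of_nonneg (Finset.subset_univ {x, y})
    (f := fun a => ∑ b, G.cond a b * (f a - f b) ^ 2)
    (fun a _ _ => Finset.sum_nonneg fun b _ => hn a b)
  rw [Finset.sum_pair hxy] at h2
  have h3 := h1 x y
  have h4 := h1 y x
  rw [G.cond_symm y x, sub_sq_comm] at h4
  rw [energy]
  linarith

/-- Induction along a path, each edge being controlled by its own conductance. The constant only
serves to start the construction; the sharp one is the resistance. -/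
theorem exists_sq_sub_le (x y : V) : ∃ K, ∀ f : V → ℝ, (f x - f y) ^ 2 ≤ K * G.energy f := by
  obtain ⟨w⟩ := G.connected.preconnected x y
  induction w with
  | nil => exact ⟨0, fun f => by simp⟩
  | @cons a b c h _ ih =>
    obtain ⟨K, hK⟩ := ih
    have hc := (G.cond_pos_iff a b).2 h
    refine ⟨2 * (G.cond a b)⁻¹ + 2 * K, fun f => ?_⟩
    have h1 : (f a - f b) ^ 2 ≤ (G.cond a b)⁻¹ * G.energy f := by
      rw [← div_eq_inv_mul, le_div_iff₀ hc, mul_comm]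
      exact G.cond_mul_sq_le_energy f a b
    nlinarith [hK f, sq_nonneg ((f a - f b) - (f b - f c))]

/-- The constant net of the energy of a network. -/
noncomputable def energyNet : EnergyNet V Unit where
  form _ := G.bilin
  symm _ f g := by simp only [bilin_apply, mul_comm]
  nonneg _ f := (G.bilin_self f).symm ▸ G.energy_nonneg f
  mono _ _ _ _ := le_rfl
  const_left _ c f := by simp [bilin_apply]
  continuous_self _ := by simpa only [bilin_self] using G.continuous_energy
  bound x y := (G.exists_sq_sub_le x y).choose
  sq_sub_le x y := Eventually.of_forall fun _ f =>
    (G.bilin_self f).symm ▸ (G.exists_sq_sub_le x y).choose_spec f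
  markov _ f := by simpa only [bilin_self] using G.energy_clip_le f
  separates x y hxy := by
    classical
    exact ⟨Pi.single x 1, _, by simp [hxy.symm], fun _ => le_rfl⟩

/-- Transport of a network along an equivalence. -/
theorem exists_congr {W : Type*} [Fintype W] (e : W ≃ V) :
    ∃ H : FiniteNetwork W, ∀ x y, H.resistance x y = G.resistance (e x) (e y) := by
  let H : FiniteNetwork W :=
    { graph := G.graph.comap e
      connected := (SimpleGraph.Iso.comap e G.graph).connected_iff.2 G.connected
      cond := fun x y => G.cond (e x) (e y)
      cond_nonneg := fun x y => G.cond_nonneg _ _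
      cond_symm := fun x y => G.cond_symm _ _
      cond_pos_iff := fun x y => G.cond_pos_iff _ _ }
  have hH : ∀ f : V → ℝ, H.energy (f ∘ e) = G.energy f := fun f => by
    simp only [energy, Function.comp_apply, H]
    rw [← e.sum_comp]
    simp only [← e.sum_comp (fun y => G.cond _ y * (f _ - f y) ^ 2)]
  refine ⟨H, fun x y => ?_⟩
  refine (Function.Surjective.iSup_congr (fun f : V → ℝ => f ∘ e) (fun g => ⟨g ∘ e.symm, by
    funext z; simp⟩) fun f => ?_).symm
  rw [hH]
  rfl

/-- A network is determined to have resistance `d` by the energy inequality and the existence of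
functions attaining it. -/
theorem resistance_eq_ofReal {x y : V} {d : ℝ} (h : ∀ f : V → ℝ, (f x - f y) ^ 2 ≤ d * G.energy f)
    (hu : ∃ u : V → ℝ, u x - u y = d ∧ G.energy u ≤ d) : G.resistance x y = ENNReal.ofReal d := by
  refine le_antisymm (iSup₂_le fun f hf => ?_) ?_
  · refine ENNReal.ofReal_le_ofReal ?_
    rw [div_le_iff₀ hf, sq_abs]
    exact h f
  · obtain ⟨u, hd, hE⟩ := hu
    rcases le_or_gt d 0 with h0 | h0
    · simp [ENNReal.ofReal_of_nonpos h0]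
    have h1 := h u
    rw [hd] at h1
    have h2 : 0 < G.energy u := by nlinarith
    refine le_trans ?_ (le_iSup₂ (f := fun (f : V → ℝ) (_ : 0 < G.energy f) =>
      ENNReal.ofReal (|f x - f y| ^ 2 / G.energy f)) u h2)
    refine ENNReal.ofReal_le_ofReal ?_
    rw [le_div_iff₀ h2, sq_abs, hd]
    nlinarith

variable [Nonempty V]

/-- The resistance form of a finite network. -/
noncomputable def toResistanceForm : ResistanceForm V := G.energyNet.toResistanceForm

theorem mem_dom (f : V → ℝ) : f ∈ G.toResistanceForm.dom := ⟨_, fun _ => le_rfl⟩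

theorem toResistanceForm_form_self (f : G.toResistanceForm.dom) :
    G.toResistanceForm.form f f = G.energy f :=
  (tendsto_nhds_unique (G.energyNet.tendsto_limit f.2 f.2) (tendsto_const_nhds)).trans
    (G.bilin_self f)

theorem toResistanceForm_resistance (x y : V) :
    G.toResistanceForm.resistance x y = G.resistance x y := by
  refine le_antisymm (iSup₂_le fun f hf => ?_) (iSup₂_le fun f hf => ?_)
  · rw [toResistanceForm_form_self] at hf ⊢
    exact le_iSup₂ (f := fun (f : V → ℝ) (_ : 0 < G.energy f) =>
      ENNReal.ofReal (|f x - f y| ^ 2 / G.energy f)) (f : V → ℝ) hf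
  · have h := G.toResistanceForm_form_self ⟨f, G.mem_dom f⟩
    have := le_iSup₂ (f := fun (f : G.toResistanceForm.dom) (_ : 0 < G.toResistanceForm.form f f) =>
      ENNReal.ofReal (|(f : V → ℝ) x - (f : V → ℝ) y| ^ 2 / G.toResistanceForm.form f f))
      ⟨f, G.mem_dom f⟩ (by rwa [h])
    rwa [h] at this

theorem sq_sub_le_resistance (f : V → ℝ) (x y : V) :
    (f x - f y) ^ 2 ≤ (G.resistance x y).toReal * G.energy f := by
  have := G.toResistanceForm.sq_sub_le ⟨f, G.mem_dom f⟩ x y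
  rwa [toResistanceForm_resistance, toResistanceForm_form_self] at this

theorem exists_potential (o x : V) : ∃ u : V → ℝ, u o = 0 ∧ u x = (G.resistance x o).toReal ∧
    G.energy u = (G.resistance x o).toReal := by
  have h1 := G.toResistanceForm.form_potential_self o x
  have h2 := h1
  rw [G.toResistanceForm.form_potential] at h2
  rw [toResistanceForm_form_self] at h1
  rw [toResistanceForm_resistance] at h1 h2
  refine ⟨fun z => (G.toResistanceForm.potential o x : V → ℝ) z -
    (G.toResistanceForm.potential o x : V → ℝ) o, sub_self _, h2, ?_⟩
  rw [← h1]
  simp [energy]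

end FiniteNetwork

theorem FiniteNetwork.isAssociated_toResistanceForm {V : Type*} [Fintype V] [Nonempty V]
    [MetricSpace V] (G : FiniteNetwork V) (h : ∀ x y, G.resistance x y = edist x y) :
    G.toResistanceForm.IsAssociated := fun x y => by
  rw [G.toResistanceForm_resistance, h]

/-! ### From a resistance metric to a resistance form. -/

namespace IsResistanceMetric

variable {X : Type*} [MetricSpace X]

theorem exists_network (hX : IsResistanceMetric X) {ι : Type*} [Fintype ι] [Nonempty ι]
    (p : ι → X) (hp : Function.Injective p) :
    ∃ G : FiniteNetwork ι, ∀ i j, G.resistance i j = edist (p i) (p j) := by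
  classical
  let V : Finset X := Finset.univ.map ⟨p, hp⟩
  obtain ⟨G, hG⟩ := hX V (Finset.univ_nonempty.map)
  let e : ι ≃ V := Equiv.ofBijective (fun i => ⟨p i, by simp [V]⟩)
    ⟨fun i j h => hp (congrArg Subtype.val h), fun ⟨x, hx⟩ => by
      obtain ⟨i, -, rfl⟩ := Finset.mem_map.1 hx
      exact ⟨i, rfl⟩⟩
  obtain ⟨H, hH⟩ := G.exists_congr e
  exact ⟨H, fun i j => (hH i j).trans (hG _ _)⟩

variable (hX : IsResistanceMetric X) (o : X)

open Classical in
/-- The finite subset `V` together with a base point `o`. -/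
abbrev Pointed {X : Type*} (o : X) (V : Finset X) : Type _ := ↥(insert o V)

instance nonempty_pointed {X : Type*} (o : X) (V : Finset X) : Nonempty (Pointed o V) := ⟨⟨o, by simp⟩⟩

/-- The restriction of functions to a finite subset. -/
def restrict {X : Type*} (o : X) (V : Finset X) : (X → ℝ) →ₗ[ℝ] (Pointed o V → ℝ) :=
  LinearMap.funLeft ℝ ℝ Subtype.val

@[simp] theorem restrict_apply {X : Type*} (o : X) (V : Finset X) (f : X → ℝ) (x : Pointed o V) :
    restrict o V f x = f x := rfl

/-- A network with the given resistances on a finite subset. -/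
noncomputable def network (V : Finset X) : FiniteNetwork (Pointed o V) :=
  (hX.exists_network (Subtype.val : Pointed o V → X) Subtype.val_injective).choose

theorem network_resistance (V : Finset X) (x y : Pointed o V) :
    (hX.network o V).resistance x y = edist x y :=
  (hX.exists_network (Subtype.val : Pointed o V → X) Subtype.val_injective).choose_spec x y

theorem network_resistance_toReal (V : Finset X) (x y : Pointed o V) :
    ((hX.network o V).resistance x y).toReal = dist x y := by
  rw [network_resistance, edist_dist, ENNReal.toReal_ofReal dist_nonneg]

theorem isAssociated_network (V : Finset X) : (hX.network o V).toResistanceForm.IsAssociated :=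
  (hX.network o V).isAssociated_toResistanceForm (hX.network_resistance o V)

/-- The networks on nested sets are chosen independently, but both induce the same metric, so the
dual formula makes them compatible. -/
theorem energy_mono (f : X → ℝ) :
    Monotone fun V => (hX.network o V).energy (restrict o V f) := by
  classical
  intro V W hVW
  have hsub : insert o V ⊆ insert o W := Finset.insert_subset_insert o hVW
  let p : Pointed o V → Pointed o W := fun x => ⟨x, hsub x.2⟩
  have hp : Isometry p := fun x y => rfl
  obtain ⟨g, hg, hle⟩ := (hX.isAssociated_network o V).exists_comp (hX.isAssociated_network o W) hp
    ⟨restrict o W f, FiniteNetwork.mem_dom _ _⟩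
  rw [FiniteNetwork.toResistanceForm_form_self, FiniteNetwork.toResistanceForm_form_self, hg] at hle
  exact hle

theorem sq_sub_le_energy (V : Finset X) {x y : X} (hx : x ∈ V) (hy : y ∈ V) (f : X → ℝ) :
    (f x - f y) ^ 2 ≤ dist x y * (hX.network o V).energy (restrict o V f) := by
  classical
  have := (hX.network o V).sq_sub_le_resistance (restrict o V f)
    ⟨x, Finset.mem_insert_of_mem hx⟩ ⟨y, Finset.mem_insert_of_mem hy⟩
  rwa [network_resistance_toReal] at this

theorem continuous_energy_restrict (V : Finset X) :
    Continuous fun f => (hX.network o V).energy (restrict o V f) :=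
  (hX.network o V).continuous_energy.comp (by
    refine continuous_pi fun x => ?_
    simp only [restrict_apply]
    fun_prop)

/-- Compactness: potentials on the finite networks, extended by zero, are bounded at each point and
converge along an ultrafilter finer than `atTop`. Monotonicity and continuity of the energies carry
the bound to the limit. -/
theorem exists_potential (x y : X) : ∃ f : X → ℝ, f y = 0 ∧ f x = dist x y ∧
    ∀ V, (hX.network o V).energy (restrict o V f) ≤ dist x y := by
  classical
  have hex : ∀ V : Finset X, ∃ f : X → ℝ, x ∈ V → y ∈ V → f y = 0 ∧ f x = dist x y ∧
      (hX.network o V).energy (restrict o V f) = dist x y := by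
    intro V
    by_cases hx : x ∈ V
    swap
    · exact ⟨0, fun h => absurd h hx⟩
    by_cases hy : y ∈ V
    swap
    · exact ⟨0, fun _ h => absurd h hy⟩
    obtain ⟨u, h1, h2, h3⟩ := (hX.network o V).exists_potential
      ⟨y, Finset.mem_insert_of_mem hy⟩ ⟨x, Finset.mem_insert_of_mem hx⟩
    rw [network_resistance_toReal] at h2 h3
    have hu : restrict o V (fun z => if hz : z ∈ insert o V then u ⟨z, hz⟩ else 0) = u := by
      funext z
      simp only [restrict_apply, dif_pos z.2]
    refine ⟨fun z => if hz : z ∈ insert o V then u ⟨z, hz⟩ else 0, fun _ _ => ⟨?_, ?_, ?_⟩⟩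
    · exact (dif_pos (Finset.mem_insert_of_mem hy)).trans h1
    · exact (dif_pos (Finset.mem_insert_of_mem hx)).trans h2
    · rw [hu, h3]; rfl
  choose h hh using hex
  let U : Ultrafilter (Finset X) := Ultrafilter.of atTop
  have hU : ∀ x : X, ∀ᶠ V in (U : Filter (Finset X)), x ∈ V := fun x =>
    Ultrafilter.of_le atTop ((eventually_ge_atTop {x}).mono fun V hV =>
      hV (Finset.mem_singleton_self x))
  have hlim : ∀ z, ∃ a, Tendsto (fun V => h V z) U (𝓝 a) := fun z => by
    refine U.exists_tendsto_of_eventually_abs_le _ (dist z y + dist x y) ?_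
    filter_upwards [hU x, hU y, hU z] with V hx hy hz
    obtain ⟨h1, -, h3⟩ := hh V hx hy
    have := hX.sq_sub_le_energy o V hz hy (h V)
    rw [h1, h3, sub_zero] at this
    have hzy : 0 ≤ dist z y := dist_nonneg
    have hxy : 0 ≤ dist x y := dist_nonneg
    exact abs_le_of_sq_le_sq (by nlinarith) (by positivity)
  choose f hf using hlim
  refine ⟨f, ?_, ?_, fun V => ?_⟩
  · refine tendsto_nhds_unique (hf y) (tendsto_const_nhds.congr' ?_)
    filter_upwards [hU x, hU y] with V hx hy using (hh V hx hy).1.symm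
  · refine tendsto_nhds_unique (hf x) (tendsto_const_nhds.congr' ?_)
    filter_upwards [hU x, hU y] with V hx hy using (hh V hx hy).2.1.symm
  · refine le_of_tendsto (((hX.continuous_energy_restrict o V).tendsto f).comp
      (tendsto_pi_nhds.2 hf)) ?_
    filter_upwards [hU x, hU y, Ultrafilter.of_le atTop (eventually_ge_atTop V)] with W hx hy hVW
    exact (hX.energy_mono o (h W) hVW).trans (hh W hx hy).2.2.le

/-- The net of energies of the networks on the finite subsets of a space with a resistance
metric. -/
noncomputable def energyNet : EnergyNet X (Finset X) where
  form V := (hX.network o V).bilin.compl₁₂ (restrict o V) (restrict o V)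
  symm V f g := (hX.network o V).energyNet.symm () _ _
  nonneg V f := (hX.network o V).energyNet.nonneg () _
  mono f := by
    simpa only [LinearMap.compl₁₂_apply, FiniteNetwork.bilin_self] using hX.energy_mono o f
  const_left V c f := (hX.network o V).energyNet.const_left () c _
  continuous_self V := by
    simpa only [LinearMap.compl₁₂_apply, FiniteNetwork.bilin_self] using
      hX.continuous_energy_restrict o V
  bound := dist
  sq_sub_le x y := by
    classical
    filter_upwards [eventually_ge_atTop {x, y}] with V hV f
    simpa only [LinearMap.compl₁₂_apply, FiniteNetwork.bilin_self] using
      hX.sq_sub_le_energy o V (hV (by simp)) (hV (by simp)) f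
  markov V f := (hX.network o V).energyNet.markov () _
  separates x y hxy := by
    obtain ⟨f, hy, hx, hf⟩ := hX.exists_potential o x y
    refine ⟨f, dist x y, by rw [hx, hy]; exact (dist_pos.2 hxy).ne', fun V => ?_⟩
    simpa only [LinearMap.compl₁₂_apply, FiniteNetwork.bilin_self] using hf V

/-- A resistance metric is the metric of a resistance form. -/
theorem exists_isAssociated [Nonempty X] (hX : IsResistanceMetric X) :
    ∃ E : ResistanceForm X, E.IsAssociated := by
  let o : X := Classical.arbitrary X
  let N := hX.energyNet o
  refine ⟨N.toResistanceForm, fun x y => le_antisymm (iSup₂_le fun f hf => ?_) ?_⟩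
  · rw [edist_dist]
    refine ENNReal.ofReal_le_ofReal ?_
    rw [div_le_iff₀ hf, sq_abs]
    exact N.limit_sq_sub_le f.2 x y
  · rcases eq_or_ne x y with rfl | hxy
    · simp
    obtain ⟨f, hy, hx, hf⟩ := hX.exists_potential o x y
    have hf' : ∀ V, N.form V f f ≤ dist x y := fun V => by
      simpa only [N, energyNet, LinearMap.compl₁₂_apply, FiniteNetwork.bilin_self] using hf V
    have hmem : f ∈ N.dom := ⟨_, hf'⟩
    have h1 : N.limit f f ≤ dist x y := N.limit_le hf'
    have h2 : (f x - f y) ^ 2 ≤ dist x y * N.limit f f := N.limit_sq_sub_le hmem x y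
    have hd : 0 < dist x y := dist_pos.2 hxy
    rw [hx, hy, sub_zero, sq] at h2
    -- The limiting potential attains the supremum defining the resistance.
    have h3 : N.limit f f = dist x y := le_antisymm h1 (le_of_mul_le_mul_left h2 hd)
    have h4 : N.toResistanceForm.form ⟨f, hmem⟩ ⟨f, hmem⟩ = dist x y := h3
    refine le_of_eq_of_le ?_ (le_iSup₂ (f := fun (f : N.toResistanceForm.dom)
      (_ : 0 < N.toResistanceForm.form f f) =>
      ENNReal.ofReal (|(f : X → ℝ) x - (f : X → ℝ) y| ^ 2 / N.toResistanceForm.form f f))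
      ⟨f, hmem⟩ (by rwa [h4]))
    rw [h4]
    change _ = ENNReal.ofReal (|f x - f y| ^ 2 / dist x y)
    rw [hx, hy, sub_zero, sq_abs, sq, mul_div_cancel_right₀ _ hd.ne', edist_dist]

end IsResistanceMetric

/-! ### Limits of resistance metrics. -/

theorem FiniteNetwork.cond_self {V : Type*} (G : FiniteNetwork V) (x : V) : G.cond x x = 0 :=
  le_antisymm (not_lt.1 fun h => G.graph.irrefl ((G.cond_pos_iff x x).1 h)) (G.cond_nonneg x x)

/-- The potential between `x` and `y` has increment and energy both equal to the resistance, and one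
edge carries at most the whole energy. -/
theorem FiniteNetwork.cond_mul_resistance_le {V : Type*} [Fintype V] [Nonempty V]
    (G : FiniteNetwork V) (x y : V) : G.cond x y * (G.resistance x y).toReal ≤ 1 := by
  obtain ⟨u, h1, h2, h3⟩ := G.exists_potential y x
  have h := G.cond_mul_sq_le_energy u x y
  rw [h1, h2, h3, sub_zero] at h
  rcases (ENNReal.toReal_nonneg (a := G.resistance x y)).eq_or_lt with h0 | h0
  · rw [← h0]; simp
  · refine le_of_mul_le_mul_right ?_ h0
    rw [one_mul]
    linarith

/-- A nonnegative symmetric kernel whose energy controls the differences of functions is the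
conductance of a network. -/
theorem FiniteNetwork.exists_of_cond {V : Type*} [Fintype V] [Nonempty V] (c : V → V → ℝ)
    (hc : ∀ x y, 0 ≤ c x y) (hsymm : ∀ x y, c x y = c y x) (hself : ∀ x, c x x = 0)
    (d : V → V → ℝ)
    (h : ∀ (f : V → ℝ) x y, (f x - f y) ^ 2 ≤
      d x y * ((1 / 2) * ∑ x, ∑ y, c x y * (f x - f y) ^ 2)) :
    ∃ G : FiniteNetwork V, G.cond = c := by
  classical
  let Γ : SimpleGraph V :=
    { Adj := fun x y => 0 < c x y
      symm := ⟨fun x y hxy => by rwa [hsymm]⟩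
      loopless := ⟨fun x hx => by rw [hself] at hx; exact lt_irrefl _ hx⟩ }
  refine ⟨⟨Γ, (SimpleGraph.connected_iff _).2 ⟨fun x y => ?_, inferInstance⟩, c, hc, hsymm,
    fun x y => Iff.rfl⟩, rfl⟩
  by_contra hxy
  have h0 : ∀ a b, c a b * ((if Γ.Reachable x a then (1 : ℝ) else 0) -
      if Γ.Reachable x b then (1 : ℝ) else 0) ^ 2 = 0 := by
    intro a b
    rcases (hc a b).eq_or_lt with h0 | h0
    · rw [← h0, zero_mul]
    · have hab : Γ.Adj a b := h0
      have : Γ.Reachable x a ↔ Γ.Reachable x b :=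
        ⟨fun h => h.trans hab.reachable, fun h => h.trans hab.symm.reachable⟩
      simp [this]
  -- The indicator of the component of `x` has zero energy, yet it would separate `x` from `y`.
  have h1 := h (fun z => if Γ.Reachable x z then 1 else 0) x y
  simp only [h0, Finset.sum_const_zero, mul_zero, if_neg hxy, SimpleGraph.Reachable.refl,
    if_true] at h1
  norm_num at h1

/-- A limit of resistance metrics is a resistance metric. -/
theorem IsResistanceMetric.of_tendsto {X ι : Type*} [MetricSpace X] {l : Filter ι} [l.NeBot]
    {Y : ι → Type*} [∀ i, MetricSpace (Y i)] (hY : ∀ i, IsResistanceMetric (Y i))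
    (p : ∀ i, X → Y i)
    (hp : ∀ x y, Tendsto (fun i => dist (p i x) (p i y)) l (𝓝 (dist x y))) :
    IsResistanceMetric X := by
  intro V hV
  have : Nonempty V := hV.to_subtype
  let U : Ultrafilter ι := Ultrafilter.of l
  have hpU : ∀ x y : V, Tendsto (fun i => dist (p i x) (p i y)) U (𝓝 (dist x y)) :=
    fun x y => (hp x y).mono_left (Ultrafilter.of_le l)
  -- Distinct images are needed to pull a network on the image back to `V`.
  have hinj : ∀ᶠ i in (U : Filter ι), Function.Injective fun x : V => p i x := by
    have : ∀ x y : V, ∀ᶠ i in (U : Filter ι), p i x = p i y → x = y := by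
      intro x y
      rcases eq_or_ne x y with rfl | hxy
      · exact Eventually.of_forall fun _ _ => rfl
      · filter_upwards [(hpU x y).eventually_ne (dist_pos.2 hxy).ne'] with i hi h
        exact absurd (dist_eq_zero.2 h) hi
    filter_upwards [eventually_all.2 fun x => eventually_all.2 (this x)] with i hi x y
    exact hi x y
  have hex : ∀ᶠ i in (U : Filter ι), ∃ G : FiniteNetwork V,
      ∀ x y : V, (G.resistance x y).toReal = dist (p i x) (p i y) := by
    filter_upwards [hinj] with i hi
    obtain ⟨G, hG⟩ := (hY i).exists_network _ hi
    exact ⟨G, fun x y => by rw [hG, edist_dist, ENNReal.toReal_ofReal dist_nonneg]⟩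
  have : Nonempty (FiniteNetwork V) := by
    obtain ⟨i, G, -⟩ := hex.exists
    exact ⟨G⟩
  obtain ⟨G, hG⟩ := hex.choice
  have hcond : ∀ x y, ∃ a, Tendsto (fun i => (G i).cond x y) U (𝓝 a) := by
    intro x y
    rcases eq_or_ne x y with rfl | hxy
    · exact ⟨0, tendsto_const_nhds.congr fun i => ((G i).cond_self x).symm⟩
    have hd : 0 < dist x y := dist_pos.2 hxy
    -- Conductance times resistance is at most 1, and the resistance eventually exceeds half its
    -- limit.
    refine U.exists_tendsto_of_eventually_abs_le _ (2 / dist x y) ?_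
    filter_upwards [hG, (hpU x y).eventually_const_lt (half_lt_self hd)] with i hi hlt
    have h1 := (G i).cond_mul_resistance_le x y
    rw [hi] at h1
    rw [abs_of_nonneg ((G i).cond_nonneg x y), le_div_iff₀ hd]
    have := mul_le_mul_of_nonneg_left hlt.le ((G i).cond_nonneg x y)
    linarith
  choose c hc using hcond
  have henergy : ∀ (u : ι → V → ℝ) (f : V → ℝ), (∀ x, Tendsto (fun i => u i x) U (𝓝 (f x))) →
      Tendsto (fun i => (G i).energy (u i)) U
        (𝓝 ((1 / 2) * ∑ x, ∑ y, c x y * (f x - f y) ^ 2)) := fun u f hu =>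
    (tendsto_finsetSum _ fun x _ => tendsto_finsetSum _ fun y _ =>
      (hc x y).mul (((hu x).sub (hu y)).pow 2)).const_mul _
  -- Conductances may vanish in the limit; this inequality survives and keeps the limiting graph
  -- connected.
  have hle : ∀ (f : V → ℝ) x y, (f x - f y) ^ 2 ≤
      dist x y * ((1 / 2) * ∑ x, ∑ y, c x y * (f x - f y) ^ 2) := by
    intro f x y
    refine ge_of_tendsto ((hpU x y).mul (henergy (fun _ => f) f fun _ => tendsto_const_nhds)) ?_
    filter_upwards [hG] with i hi
    rw [← hi]
    exact (G i).sq_sub_le_resistance f x y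
  obtain ⟨H, hH⟩ := FiniteNetwork.exists_of_cond c
    (fun x y => ge_of_tendsto' (hc x y) fun i => (G i).cond_nonneg x y)
    (fun x y => tendsto_nhds_unique (hc x y) ((hc y x).congr fun i => (G i).cond_symm y x))
    (fun x => tendsto_nhds_unique (hc x x)
      (tendsto_const_nhds.congr fun i => ((G i).cond_self x).symm)) dist hle
  refine ⟨H, fun x y => ?_⟩
  rw [edist_dist]
  refine H.resistance_eq_ofReal (fun f => by rw [FiniteNetwork.energy, hH]; exact hle f x y) ?_
  -- The limit of these potentials attains equality in `hle`.
  choose u hu using fun i => (G i).exists_potential y x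
  have hlim : ∀ z, ∃ a, Tendsto (fun i => u i z) U (𝓝 a) := fun z => by
    refine U.exists_tendsto_of_eventually_abs_le _ ((dist z y + 1) + (dist x y + 1)) ?_
    filter_upwards [hG, (hpU z y).eventually_lt_const (lt_add_one _),
      (hpU x y).eventually_lt_const (lt_add_one _)] with i hi h1 h2
    have h := (G i).sq_sub_le_resistance (u i) z y
    rw [(hu i).1, (hu i).2.2, sub_zero, hi, hi] at h
    have h3 : 0 ≤ dist (p i z) (p i y) := dist_nonneg
    have h4 : 0 ≤ dist (p i x) (p i y) := dist_nonneg
    exact (abs_le_of_sq_le_sq (b := dist (p i z) (p i y) + dist (p i x) (p i y))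
      (by nlinarith) (by positivity)).trans (add_le_add h1.le h2.le)
  choose f hf using hlim
  refine ⟨f, ?_, ?_⟩
  · refine tendsto_nhds_unique ((hf x).sub (hf y)) ((hpU x y).congr' ?_)
    filter_upwards [hG] with i hi
    rw [(hu i).1, (hu i).2.1, hi, sub_zero]
  · rw [FiniteNetwork.energy, hH]
    refine (tendsto_nhds_unique (henergy u f hf) ((hpU x y).congr' ?_)).le
    filter_upwards [hG] with i hi
    rw [(hu i).2.2, hi]

/-! ### Almost isometric maps from local Gromov-Hausdorff convergence. -/

/-- If the local Hausdorff distance of `A` and `B` is small, the points of `B` near the root are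
close to `A`. -/
theorem exists_dist_lt_of_localHausdorffDist_lt {M : Type*} [MetricSpace M] {ρ : M} {A B : Set M}
    {b : M} (hb : b ∈ B) {ε : ℝ} (hε1 : ε ≤ 1)
    (h : localHausdorffDist ρ A B < ENNReal.ofReal (Real.exp (-(dist b ρ + 1)) * ε)) :
    ∃ a ∈ A, dist b a < ε := by
  by_contra! hA
  refine absurd h (not_lt.2 ?_)
  set D := dist b ρ with hD
  have hD0 : 0 ≤ D := dist_nonneg
  -- For radii in this unit window `b` lies in the ball, the weight is at least `exp (-(D + 1))`,
  -- and the Hausdorff distance is at least `ε`.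
  have hbound : ∀ r ∈ Set.Ioo D (D + 1), ENNReal.ofReal (Real.exp (-(D + 1)) * ε) ≤
      ENNReal.ofReal (Real.exp (-r)) * min 1 (Metric.hausdorffEDist
        (closure (A ∩ Metric.ball ρ r)) (closure (B ∩ Metric.ball ρ r))) := by
    intro r hr
    rw [ENNReal.ofReal_mul (Real.exp_pos _).le]
    refine mul_le_mul' (ENNReal.ofReal_le_ofReal (Real.exp_le_exp.2 (by linarith [hr.2])))
      (le_min (by simpa using hε1) ?_)
    have hmem : b ∈ closure (B ∩ Metric.ball ρ r) := subset_closure ⟨hb, hr.1⟩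
    refine le_trans ?_ ((Metric.infEDist_le_hausdorffEDist_of_mem hmem).trans
      Metric.hausdorffEDist_comm.le)
    rw [Metric.infEDist_closure, Metric.le_infEDist]
    intro a ha
    rw [edist_dist]
    exact ENNReal.ofReal_le_ofReal (hA a ha.1)
  calc ENNReal.ofReal (Real.exp (-(D + 1)) * ε)
      = ∫⁻ _ in Set.Ioo D (D + 1), ENNReal.ofReal (Real.exp (-(D + 1)) * ε) := by
        rw [setLIntegral_const, Real.volume_Ioo]; simp
    _ ≤ ∫⁻ r in Set.Ioo D (D + 1), ENNReal.ofReal (Real.exp (-r)) * min 1 (Metric.hausdorffEDist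
        (closure (A ∩ Metric.ball ρ r)) (closure (B ∩ Metric.ball ρ r))) :=
        setLIntegral_mono' measurableSet_Ioo hbound
    _ ≤ localHausdorffDist ρ A B :=
        lintegral_mono_set fun r hr => lt_of_le_of_lt hD0 hr.1

/-- A bound on the local Gromov-Hausdorff distance gives a root-preserving map which almost
preserves distances near the root. -/
theorem exists_map_of_localGHDist_lt {X Y : Type u} [MetricSpace X] [ProperSpace X]
    [MetricSpace Y] {ρX : X} {ρY : Y} {δ : ℝ≥0∞} (h : localGHDist ρX ρY < δ) :
    ∃ p : Y → X, p ρY = ρX ∧ ∀ (ε : ℝ) (y z : Y), ε ≤ 1 →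
      δ ≤ ENNReal.ofReal (Real.exp (-(dist y ρY + 1)) * ε) →
      δ ≤ ENNReal.ofReal (Real.exp (-(dist z ρY + 1)) * ε) →
      |dist (p y) (p z) - dist y z| < 2 * ε := by
  simp only [localGHDist, iInf_lt_iff] at h
  obtain ⟨M, _, _, ρ, f, g, hf, hg, hfρ, hgρ, h⟩ := h
  have hcl : IsClosed (Set.range f) := hf.isClosedEmbedding.isClosed_range
  -- Nearest points do not depend on `ε`, so one map serves all scales, and it sends root to root
  -- exactly.
  have hex : ∀ y, ∃ x, Metric.infDist (g y) (Set.range f) = dist (g y) (f x) := fun y => by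
    obtain ⟨_, ⟨x, rfl⟩, hx⟩ := hcl.exists_infDist_eq_dist (Set.range_nonempty_iff_nonempty.2 ⟨ρX⟩) (g y)
    exact ⟨x, hx⟩
  choose p hp using hex
  refine ⟨p, ?_, fun ε y z hε1 hy hz => ?_⟩
  · have h1 := hp ρY
    rw [hgρ, Metric.infDist_zero_of_mem (Set.mem_range.2 ⟨ρX, hfρ⟩), ← hfρ] at h1
    exact (hf.injective (dist_eq_zero.1 h1.symm)).symm
  · have key : ∀ y, δ ≤ ENNReal.ofReal (Real.exp (-(dist y ρY + 1)) * ε) →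
        dist (g y) (f (p y)) < ε := fun y hy => by
      obtain ⟨_, ⟨x, rfl⟩, hx⟩ := exists_dist_lt_of_localHausdorffDist_lt
        (Set.mem_range_self y) hε1 (h.trans_le (by rwa [← hgρ, hg.dist_eq]))
      exact (hp y).symm.trans_lt ((Metric.infDist_le_dist_of_mem (Set.mem_range_self x)).trans_lt hx)
    have h1 := key y hy
    have h2 := key z hz
    rw [← hf.dist_eq, ← hg.dist_eq]
    have h3 := dist_dist_dist_le (f (p y)) (f (p z)) (g y) (g z)
    rw [Real.dist_eq, dist_comm (f (p y)) (g y), dist_comm (f (p z)) (g z)] at h3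
    linarith

/-- Local Gromov-Hausdorff convergence gives root-preserving maps, the distances of the images
under which converge. -/
theorem exists_maps_of_tendsto_localGHDist {F : ℕ → Type u} [∀ n, MetricSpace (F n)]
    [∀ n, ProperSpace (F n)] {ρ : ∀ n, F n} {Y : Type u} [MetricSpace Y] {ρY : Y}
    (h : Tendsto (fun n => localGHDist (ρ n) ρY) atTop (𝓝 0)) :
    ∃ p : ∀ n, Y → F n, (∀ᶠ n in atTop, p n ρY = ρ n) ∧
      ∀ y z, Tendsto (fun n => dist (p n y) (p n z)) atTop (𝓝 (dist y z)) := by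
  -- The added term makes the inequality strict as soon as the distance is finite.
  let δ : ℕ → ℝ≥0∞ := fun n => localGHDist (ρ n) ρY + ((n : ℝ≥0∞) + 1)⁻¹
  have hδ : Tendsto δ atTop (𝓝 0) := by
    have h1 : Tendsto (fun n : ℕ => ((n : ℝ≥0∞) + 1)⁻¹) atTop (𝓝 0) := by
      have := (tendsto_add_atTop_iff_nat 1).2 ENNReal.tendsto_inv_nat_nhds_zero
      simpa using this
    simpa using h.add h1
  have hex : ∀ n, ∃ p : Y → F n, localGHDist (ρ n) ρY < δ n → p ρY = ρ n ∧
      ∀ (ε : ℝ) (y z : Y), ε ≤ 1 →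
      δ n ≤ ENNReal.ofReal (Real.exp (-(dist y ρY + 1)) * ε) →
      δ n ≤ ENNReal.ofReal (Real.exp (-(dist z ρY + 1)) * ε) →
      |dist (p y) (p z) - dist y z| < 2 * ε := fun n => by
    by_cases hn : localGHDist (ρ n) ρY < δ n
    · obtain ⟨p, hp⟩ := exists_map_of_localGHDist_lt hn
      exact ⟨p, fun _ => hp⟩
    · exact ⟨fun _ => ρ n, fun h => absurd h hn⟩
  choose p hp using hex
  have hlt : ∀ᶠ n in atTop, localGHDist (ρ n) ρY < δ n := by
    filter_upwards [h.eventually_lt_const ENNReal.zero_lt_top] with n hn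
    exact ENNReal.lt_add_right hn.ne (by simp)
  refine ⟨p, hlt.mono fun n hn => (hp n hn).1, fun y z => ?_⟩
  refine Metric.tendsto_nhds.2 fun ε hε => ?_
  set η := min (ε / 2) 1 with hη
  have hη0 : 0 < η := by positivity
  have hpos : ∀ y, ∀ᶠ n in atTop, δ n ≤ ENNReal.ofReal (Real.exp (-(dist y ρY + 1)) * η) := fun y =>
    (hδ.eventually_lt_const (ENNReal.ofReal_pos.2 (by positivity))).mono fun _ h => h.le
  filter_upwards [hlt, hpos y, hpos z] with n hn hy hz
  have h1 := (hp n hn).2 η y z (min_le_right _ _) hy hz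
  have h2 : η ≤ ε / 2 := min_le_left _ _
  rw [Real.dist_eq]
  linarith

/-! ### Resistance to the complement of a ball. -/

namespace ResistanceForm

variable {X : Type*} (E : ResistanceForm X)

theorem effRes_anti_right (A : Set X) {B B' : Set X} (h : B ⊆ B') :
    E.effRes A B' ≤ E.effRes A B :=
  ENNReal.inv_le_inv.2 (iInf_mono fun _ => iInf_mono fun _ => le_iInf fun hB =>
    iInf_le_of_le (fun x hx => hB x (h hx)) le_rfl)

theorem ofReal_le_effRes {A B : Set X} {a : ℝ} (ha : 0 < a) (f : E.dom)
    (hA : ∀ x ∈ A, (f : X → ℝ) x = 1) (hB : ∀ x ∈ B, (f : X → ℝ) x = 0)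
    (hf : E.form f f ≤ a⁻¹) : ENNReal.ofReal a ≤ E.effRes A B := by
  rw [effRes, ENNReal.le_inv_iff_le_inv, ← ENNReal.ofReal_inv_of_pos ha]
  exact iInf_le_of_le f (iInf₂_le_of_le hA hB (ENNReal.ofReal_le_ofReal hf))

theorem exists_form_lt_of_lt_effRes {A B : Set X} {a : ℝ} (ha : 0 < a)
    (h : ENNReal.ofReal a < E.effRes A B) :
    ∃ f : E.dom, (∀ x ∈ A, (f : X → ℝ) x = 1) ∧ (∀ x ∈ B, (f : X → ℝ) x = 0) ∧
      E.form f f < a⁻¹ := by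
  rw [effRes, ENNReal.lt_inv_iff_lt_inv, ← ENNReal.ofReal_inv_of_pos ha] at h
  simp only [iInf_lt_iff] at h
  obtain ⟨f, hA, hB, h⟩ := h
  exact ⟨f, hA, hB, (ENNReal.ofReal_lt_ofReal_iff (inv_pos.2 ha)).1 h⟩

section Metric

variable {X : Type*} [MetricSpace X] (E : ResistanceForm X)

theorem effRes_compl_ball_mono (A : Set X) (x : X) :
    Monotone fun r : ℝ => E.effRes A (Metric.ball x r)ᶜ := fun _ _ h =>
  E.effRes_anti_right A (Set.compl_subset_compl.2 (Metric.ball_subset_ball h))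

variable {E}

/-- Recurrence does not depend on the root. -/
theorem IsAssociated.isRecurrent_of_tendsto (hE : E.IsAssociated) {x : X}
    (h : Tendsto (fun r : ℝ => E.effRes {x} (Metric.ball x r)ᶜ) atTop (𝓝 ⊤)) :
    E.IsRecurrent := by
  intro y
  refine ENNReal.tendsto_nhds_top fun n => ?_
  -- The first summand forces `f y ≥ 1/2`. Rescaling `f` to be 1 at `y` then costs a factor of at
  -- most 4, leaving energy at most `1/(n+1)`.
  set m : ℝ := 4 * (dist y x + n + 1) with hm
  have hd : 0 ≤ dist y x := dist_nonneg
  have hn : (0 : ℝ) ≤ n := n.cast_nonneg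
  have hm0 : 0 < m := by positivity
  obtain ⟨r, hr⟩ := (h.eventually (lt_mem_nhds (ENNReal.ofReal_lt_top (r := m)))).exists
  obtain ⟨f, hA, hB, hf⟩ := E.exists_form_lt_of_lt_effRes hm0 hr
  have he : 0 ≤ E.form f f := E.nonneg f
  have hem : 4 * (dist y x * E.form f f) + 4 * (n + 1) * E.form f f < 1 := by
    rw [← one_div, lt_div_iff₀ hm0, hm] at hf
    linarith
  have hne : 0 ≤ (n + 1) * E.form f f := by positivity
  have hfy : 1 / 2 ≤ (f : X → ℝ) y := by
    have h1 := hE.sq_sub_le f y x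
    rw [hA x rfl] at h1
    have h2 := abs_le_of_sq_le_sq (b := 1 / 2) (h1.trans (by linarith)) (by norm_num)
    linarith [(abs_le.1 h2).1]
  have hfy0 : 0 < (f : X → ℝ) y := by linarith
  have hg : E.form (((f : X → ℝ) y)⁻¹ • f) (((f : X → ℝ) y)⁻¹ • f) ≤ (n + 1 : ℝ)⁻¹ := by
    simp only [map_smul, LinearMap.smul_apply, smul_eq_mul]
    rw [← mul_assoc, ← mul_inv, ← div_eq_inv_mul, div_le_iff₀ (by positivity), ← div_eq_inv_mul,
      le_div_iff₀ (by positivity)]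
    nlinarith
  filter_upwards [eventually_ge_atTop (r + dist y x)] with s hs
  refine lt_of_lt_of_le ?_ (E.ofReal_le_effRes (a := n + 1) (by positivity)
    (((f : X → ℝ) y)⁻¹ • f) ?_ ?_ hg)
  · rw [← ENNReal.ofReal_natCast]
    exact (ENNReal.ofReal_lt_ofReal_iff (by positivity)).2 (lt_add_one _)
  · rintro z rfl
    exact inv_mul_cancel₀ hfy0.ne'
  · intro z hz
    have : z ∈ (Metric.ball x r)ᶜ := fun hzr => hz (by
      rw [Metric.mem_ball] at hzr ⊢
      linarith [dist_triangle z x y, dist_comm x y])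
    change ((f : X → ℝ) y)⁻¹ * (f : X → ℝ) z = 0
    rw [hB z this, mul_zero]

/-- Upper semicontinuity of the resistance to the complement of a ball. -/
theorem IsAssociated.limsup_effRes_le (hE : E.IsAssociated) {Y : ℕ → Type*}
    [∀ n, MetricSpace (Y n)] {G : ∀ n, ResistanceForm (Y n)} (hG : ∀ n, (G n).IsAssociated)
    (p : ∀ n, X → Y n)
    (hp : ∀ x y, Tendsto (fun n => dist (p n x) (p n y)) atTop (𝓝 (dist x y)))
    {o : X} {ρ : ∀ n, Y n} (hρ : ∀ᶠ n in atTop, p n o = ρ n) {r s : ℝ} (hrs : r < s) :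
    limsup (fun n => (G n).effRes {ρ n} (Metric.ball (ρ n) r)ᶜ) atTop ≤
      E.effRes {o} (Metric.ball o s)ᶜ := by
  refine ENNReal.le_of_forall_nnreal_lt fun a ha => ?_
  rcases eq_or_ne a 0 with rfl | ha0
  · simp
  have ha0 : 0 < (a : ℝ) := NNReal.coe_pos.2 (pos_iff_ne_zero.2 ha0)
  rw [← ENNReal.ofReal_coe_nnreal] at ha ⊢
  have hfreq := frequently_lt_of_lt_limsup (by isBoundedDefault) ha
  -- The limsup exceeds `a` only along infinitely many `n`, so the ultrafilter is taken to
  -- concentrate on those.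
  set S : Set ℕ := {n | ENNReal.ofReal a < (G n).effRes {ρ n} (Metric.ball (ρ n) r)ᶜ}
  have hne : (atTop ⊓ 𝓟 S).NeBot := frequently_mem_iff_neBot.1 hfreq
  let U : Ultrafilter ℕ := Ultrafilter.of (atTop ⊓ 𝓟 S)
  have hU : (U : Filter ℕ) ≤ atTop := (Ultrafilter.of_le _).trans inf_le_left
  have hex : ∀ n, ∃ f : (G n).dom, ENNReal.ofReal a <
      (G n).effRes {ρ n} (Metric.ball (ρ n) r)ᶜ → (f : Y n → ℝ) (ρ n) = 1 ∧
        (∀ x ∈ (Metric.ball (ρ n) r)ᶜ, (f : Y n → ℝ) x = 0) ∧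
        (G n).form f f ≤ (a : ℝ)⁻¹ := fun n => by
    by_cases h : ENNReal.ofReal a < (G n).effRes {ρ n} (Metric.ball (ρ n) r)ᶜ
    · obtain ⟨f, h1, h2, h3⟩ := (G n).exists_form_lt_of_lt_effRes ha0 h
      exact ⟨f, fun _ => ⟨h1 _ rfl, h2, h3.le⟩⟩
    · exact ⟨0, fun h' => absurd h' h⟩
  choose u hu using hex
  replace hu : ∀ᶠ n in (U : Filter ℕ), (u n : Y n → ℝ) (p n o) = 1 ∧
      (∀ x, r ≤ dist x (p n o) → (u n : Y n → ℝ) x = 0) ∧ (G n).form (u n) (u n) ≤ (a : ℝ)⁻¹ := by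
    filter_upwards [hU hρ, (Ultrafilter.of_le (atTop ⊓ 𝓟 S)).trans inf_le_right
      (mem_principal_self _)] with n hn hmem
    obtain ⟨h1, h2, h3⟩ := hu n hmem
    rw [hn]
    exact ⟨h1, fun x hx => h2 x (by simpa using hx), h3⟩
  have hlim : ∀ x, ∃ b, Tendsto (fun n => (u n : Y n → ℝ) (p n x)) U (𝓝 b) := fun x => by
    refine U.exists_tendsto_of_eventually_abs_le _ (1 + ((dist x o + 1) + (a : ℝ)⁻¹)) ?_
    filter_upwards [hu, hU ((hp x o).eventually_lt_const (lt_add_one _))] with n ⟨h1, _, h3⟩ h4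
    have h5 := (hG n).sq_sub_le (u n) (p n x) (p n o)
    rw [h1] at h5
    have h6 : 0 ≤ dist (p n x) (p n o) := dist_nonneg
    have h7 := (G n).nonneg (u n)
    have h8 := abs_le_of_sq_le_sq (b := dist (p n x) (p n o) + (G n).form (u n) (u n))
      (h5.trans (by nlinarith)) (by positivity)
    have h9 := abs_sub_abs_le_abs_sub ((u n : Y n → ℝ) (p n x)) 1
    rw [abs_one] at h9
    linarith
  choose f hf using hlim
  have : Nonempty X := ⟨o⟩
  obtain ⟨g, rfl, hle⟩ := hE.exists_of_tendsto hG p (fun x y => (hp x y).mono_left hU) u _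
    (hu.mono fun n hn => hn.2.2) f hf
  refine E.ofReal_le_effRes ha0 g ?_ ?_ hle
  · rintro _ rfl
    exact tendsto_nhds_unique (hf _)
      (tendsto_const_nhds.congr' (hu.mono fun n hn => hn.1.symm))
  · intro x hx
    -- The gap between `r` and `s` puts `p n x` eventually outside the ball of radius `r`, where `u
    -- n` vanishes.
    have hx' : r < dist x o := hrs.trans_le (by simpa using hx)
    refine tendsto_nhds_unique (hf x) (tendsto_const_nhds.congr' ?_)
    filter_upwards [hu, hU ((hp x o).eventually_const_lt hx')] with n hn h1
    exact (hn.2.1 _ h1.le).symm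

end Metric

end ResistanceForm

theorem theorem5 (F : ℕ → Type u) [∀ n, MetricSpace (F n)] [∀ n, ProperSpace (F n)]
    (ρ : ∀ n, F n) (F' : Type u) [MetricSpace F'] [ProperSpace F'] (ρ' : F')
    (hR : ∀ n, IsResistanceMetric (F n))
    (hconv : Tendsto (fun n => localGHDist (ρ n) ρ') atTop (𝓝 0)) :
    IsResistanceMetric F' ∧
    (∀ n, ∃ E : ResistanceForm (F n), E.IsAssociated) ∧
    (∃ E : ResistanceForm F', E.IsAssociated) ∧
    ∀ (E : ∀ n, ResistanceForm (F n)) (E' : ResistanceForm F'),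
      (∀ n, (E n).IsAssociated) → E'.IsAssociated →
      ∃ L L' : ℝ≥0∞,
        Tendsto (fun r : ℝ => limsup (fun n =>
          (E n).effRes {ρ n} (Metric.ball (ρ n) r)ᶜ) atTop) atTop (𝓝 L) ∧
        Tendsto (fun r : ℝ => E'.effRes {ρ'} (Metric.ball ρ' r)ᶜ) atTop (𝓝 L') ∧
        L ≤ L' ∧
        (L = ⊤ → E'.IsRecurrent) := by
  obtain ⟨p, hpρ, hp⟩ := exists_maps_of_tendsto_localGHDist hconv
  have hR' : IsResistanceMetric F' := IsResistanceMetric.of_tendsto hR p hp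
  have : Nonempty F' := ⟨ρ'⟩
  refine ⟨hR', fun n => have : Nonempty (F n) := ⟨ρ n⟩; (hR n).exists_isAssociated,
    hR'.exists_isAssociated, fun E E' hE hE' => ?_⟩
  have h1 := tendsto_atTop_iSup (f := fun r : ℝ => limsup (fun n =>
    (E n).effRes {ρ n} (Metric.ball (ρ n) r)ᶜ) atTop) fun r s hrs =>
      limsup_le_limsup (Eventually.of_forall fun n => (E n).effRes_compl_ball_mono _ _ hrs)
  have h2 := tendsto_atTop_iSup (E'.effRes_compl_ball_mono {ρ'} ρ')
  have hle : (⨆ r : ℝ, limsup (fun n => (E n).effRes {ρ n} (Metric.ball (ρ n) r)ᶜ) atTop) ≤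
      ⨆ r : ℝ, E'.effRes {ρ'} (Metric.ball ρ' r)ᶜ :=
    -- The enlarged radius disappears in the supremum.
    iSup_le fun r => (hE'.limsup_effRes_le hE p hp hpρ (lt_add_one r)).trans
      (le_iSup (fun r : ℝ => E'.effRes {ρ'} (Metric.ball ρ' r)ᶜ) (r + 1))
  refine ⟨_, _, h1, h2, hle, fun hL => hE'.isRecurrent_of_tendsto (x := ρ') ?_⟩
  rw [hL, top_le_iff] at hle
  rwa [hle] at h2
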